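/- Let $G$ be a countable discrete group and let $X$ be a compact metrizable group on which $G$ acts by continuous automorphisms. For a closed subgroup $Y\le X$ write $m_Y$ for its Haar probability measure, and let $X/Y$ be the space of left cosets. Conventions. For a probability measure-preserving (p.m.p.) action $G\curvearrowright(Z,\zeta)$, a finite set $F\subseteq G$ and a measurable map $\alpha\colon Z\to A$ to a finite set $A$, let $\alpha^F\colon Z\to A^F$, $\alpha^F(z)(g)=\alpha(g^{-1}z)$. The action $G\curvearrowright(Z,\zeta)$ is *weakly contained in a class* $\mathcal C$ of p.m.p. actions of $G$ if for all $\varepsilon>0$, all finite $F\subseteq G$ and all measurable $\alpha\colon Z\to A$ with $A$ finite there are $G\curvearrowright(W,\mu)$ in $\mathcal C$ and a measurable $\beta\colon W\to A$ with $\|(\alpha^F)_*\zeta-(\beta^F)_*\mu\|_{\ell^1(A^F)}<\varepsilon$. It is *weakly contained in a Bernoulli shift* if it is weakly contained in the one-element class $\{G\curvearrowright(B^G,\beta^{\otimes G})\}$ for some standard Borel probability space $(B,\beta)$, where $G$ acts by the left shift $(ga)(h)=a(g^{-1}h)$. The class $\mathcal C$ is *weakly closed under products* if for any two actions in $\mathcal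 C$ the diagonal action on the product probability space is weakly contained in $\mathcal C$. For a closed $G$-invariant subgroup $Y$ with quotient map $q\colon X\to X/Y$, a p.m.p. action $G\curvearrowright(Z,\zeta)$ is *$G\curvearrowright X/Y$-ergodic in the presence of $G\curvearrowright X$* if for every measurable $G$-equivariant map $\Theta\colon Z\to X$ the map $q\circ\Theta$ is $\zeta$-almost surely constant. Theorem. (1) There is a largest closed $G$-invariant subgroup $Y$ of $X$ such that $G\curvearrowright(Y,m_Y)$ is weakly contained in a Bernoulli shift. The same $Y$ is the smallest closed $G$-invariant subgroup of $X$ with the property that every p.m.p. action of $G$ weakly contained in a Bernoulli shift is $G\curvearrowright X/Y$-ergodic in the presence of $G\curvearrowright X$. (2) More generally, let $\mathcal C$ be a nonempty class of p.m.p. actions of $G$ that is weakly closed under products. Then there is a largest closed $G$-invariant subgroup $Y$ of $X$ such that $G\curvearrowright(Y,m_Y)$ is weakly contained in $\mathcal C$. The same $Y$ is the smallest closed $G$-invariant subgroup of $X$ with the property that every p.m.p. action of $G$ weakly contained in $\mathcal C$ is $G\curvearrowright X/Y$-ergodic in the presence of $G\curvearrowright X$. "Largest" and "smallest" refer to the order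 of subgroups by inclusion. -/

import Mathlib

open MeasureTheory

universe u

/-- A probability measure-preserving action of a (countable, discrete) group `G`: a probability
space with an action of `G` by measurable, measure-preserving maps. -/
structure PMPAction (G : Type u) [Group G] where
  carrier : Type u
  [measurableSpace : MeasurableSpace carrier]
  [mulAction : MulAction G carrier]
  measure : Measure carrier
  [isProbabilityMeasure : IsProbabilityMeasure measure]
  measurePreserving_smul : ∀ g : G, MeasurePreserving (fun x : carrier => g • x) measure measure

attribute [instance] PMPAction.measurableSpace PMPAction.mulAction PMPAction.isProbabilityMeasure

namespace PMPAction

variable {G : Type u} [Group G]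

/-- For an observable `α : X → A` and a finite `F ⊆ G`, the map `α^F : X → A^F`,
`α^F(x)(g) = α(g⁻¹x)`. -/
def itinerary (a : PMPAction G) {A : Type} (α : a.carrier → A) (F : Finset G) :
    a.carrier → F → A :=
  fun x g => α ((g : G)⁻¹ • x)

/-- The mass that the distribution `(α^F)_* μ` of `α^F` gives to the point `p ∈ A^F`. -/
noncomputable def law (a : PMPAction G) {A : Type} (α : a.carrier → A) (F : Finset G)
    (p : F → A) : ℝ :=
  a.measure.real (a.itinerary α F ⁻¹' {p})

open Classical in
/-- `a` is weakly contained in the class `C`: for every `ε > 0`, every finite `F ⊆ G` and every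
finite observable `α : Y → A` there are an action in `C` and a finite observable `β` on it with
values in `A` such that `‖(α^F)_* ν - (β^F)_* μ‖₁ < ε` in `ℓ¹(A^F)`. -/
def WeaklyContained (a : PMPAction G) (C : Set (PMPAction G)) : Prop :=
  ∀ ε : ℝ, 0 < ε → ∀ (F : Finset G) (A : Type) [Fintype A] (α : a.carrier → A),
    Measurable[_, ⊤] α →
      ∃ b ∈ C, ∃ β : b.carrier → A, Measurable[_, ⊤] β ∧
        ∑ p : F → A, |a.law α F p - b.law β F p| < ε

/-- The product of two actions: the diagonal action on `(X₁ × X₂, μ₁ ⊗ μ₂)`. -/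
noncomputable def prod (a b : PMPAction G) : PMPAction G where
  carrier := a.carrier × b.carrier
  measure := a.measure.prod b.measure
  measurePreserving_smul g := (a.measurePreserving_smul g).prod (b.measurePreserving_smul g)

/-- A class of actions is weakly closed under products if the product of any two of its members is
weakly contained in the class. -/
def WeaklyClosedUnderProducts (C : Set (PMPAction G)) : Prop :=
  ∀ a ∈ C, ∀ b ∈ C, (a.prod b).WeaklyContained C

/-- The left shift action of `G` on `B^G`: `(g a)(h) = a(g⁻¹h)`. -/
@[reducible] def leftShift (G : Type u) [Group G] (B : Type u) : MulAction G (G → B) where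
  smul g x := fun h => x (g⁻¹ * h)
  one_smul x := by
    funext h
    change x ((1 : G)⁻¹ * h) = x h
    simp
  mul_smul g k x := by
    funext h
    change x ((g * k)⁻¹ * h) = x (k⁻¹ * (g⁻¹ * h))
    simp [mul_assoc]

/-- The Bernoulli shift over `G` with base space `(B, β)`: the left shift action on
`(B^G, β^{⊗G})`. -/
noncomputable def bernoulli (G : Type u) [Group G] (B : Type u) [MeasurableSpace B]
    (β : Measure B) [IsProbabilityMeasure β] : PMPAction G where
  carrier := G → B
  mulAction := leftShift G B
  measure := Measure.infinitePi fun _ : G => β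
  measurePreserving_smul g := by
    change MeasurePreserving (fun (x : G → B) (h : G) => x (g⁻¹ * h)) _ _
    refine ⟨by fun_prop, ?_⟩
    exact Measure.map_infinitePi_infinitePi_of_inj (P := fun _ : G => β)
      (mul_right_injective g⁻¹)

/-- `a` is weakly contained in a Bernoulli shift (over a standard Borel probability space). -/
def WeaklyContainedInBernoulli (a : PMPAction G) : Prop :=
  ∃ (B : Type u) (_ : MeasurableSpace B) (_ : StandardBorelSpace B) (β : Measure B)
    (_ : IsProbabilityMeasure β), a.WeaklyContained {bernoulli G B β}

/-- For a factor map `q : W → V` of actions of `G`, the action `a = (G ↷ (Z, ζ))` is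
`G ↷ V`-ergodic in the presence of `G ↷ W`: for every measurable `G`-equivariant `Θ : Z → W`
the map `q ∘ Θ` is almost surely constant. -/
def ErgodicInPresence (a : PMPAction G) {W V : Type u} [MeasurableSpace W] [MulAction G W]
    (q : W → V) : Prop :=
  ∀ Θ : a.carrier → W, Measurable Θ → (∀ (g : G) (z : a.carrier), Θ (g • z) = g • Θ z) →
    ∃ v : V, ∀ᵐ z ∂a.measure, q (Θ z) = v

end PMPAction

/-- `Y` is a closed, `G`-invariant subgroup of `X`. -/
structure IsClosedInvariant (G : Type u) {X : Type u} [Group G] [Group X] [TopologicalSpace X]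
    [MulDistribMulAction G X] (Y : Subgroup X) : Prop where
  isClosed : IsClosed (Y : Set X)
  smul_mem : ∀ (g : G), ∀ y ∈ Y, g • y ∈ Y

namespace IsClosedInvariant

variable {G X : Type u} [Group G] [Group X] [TopologicalSpace X] [MulDistribMulAction G X]
  {Y : Subgroup X}

/-- The action of `G` on an invariant subgroup, by restriction. -/
@[reducible] def mulAction (h : IsClosedInvariant G Y) : MulAction G Y where
  smul g y := ⟨g • (y : X), h.smul_mem g y y.2⟩
  one_smul y := Subtype.ext (one_smul G (y : X))
  mul_smul g k y := Subtype.ext (mul_smul g k (y : X))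

variable [IsTopologicalGroup X] [CompactSpace X] [ContinuousConstSMul G X]
  [MeasurableSpace X] [BorelSpace X]

/-- The action `G ↷ (Y, m_Y)`, where `m_Y` is the Haar probability measure of the closed,
`G`-invariant subgroup `Y`. -/
noncomputable def haarAction (h : IsClosedInvariant G Y) : PMPAction G :=
  haveI : CompactSpace Y := isCompact_iff_compactSpace.mp h.isClosed.isCompact
  { carrier := Y
    mulAction := h.mulAction
    measure := Measure.haarMeasure ⊤
    isProbabilityMeasure := ⟨Measure.haarMeasure_self (K₀ := (⊤ : TopologicalSpace.PositiveCompacts Y))⟩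
    measurePreserving_smul := fun g => by
      let f : Y →* Y :=
        { toFun := fun y => ⟨g • (y : X), h.smul_mem g y y.2⟩
          map_one' := Subtype.ext (smul_one g)
          map_mul' := fun x y => Subtype.ext (smul_mul' g (x : X) (y : X)) }
      have hf : Continuous f :=
        Continuous.subtype_mk (continuous_subtype_val.const_smul g) _
      have hs : Function.Surjective f := fun y =>
        ⟨⟨g⁻¹ • (y : X), h.smul_mem g⁻¹ y y.2⟩, Subtype.ext (smul_inv_smul g (y : X))⟩
      exact f.measurePreserving hf hs rfl }

end IsClosedInvariant

/-!
Fix a class `C` that is weakly closed under products, and consider the set `S` of `G`-invariant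
probability measures `μ` on `X` such that `G ↷ (X, μ)` is weakly contained in `C`. Weak containment
in `C` passes to factors and to products (`WeaklyContained.of_factor`, `WeaklyContained.prod`) and
to weak-* limits of measures (`isClosed_containedMeasures`). Since multiplication and
`(x, y) ↦ x⁻¹y` are equivariant, `S` is a compact semigroup under convolution, and it contains the
law of `Θ(z)⁻¹Θ(w)`, for `z`, `w` independent, whenever `Θ` is an equivariant map into `X` from an
action weakly contained in `C`.

Everything follows from one well-chosen `μ ∈ S`. For continuous `f` let the energy of `μ` be the
squared `L²` norm, with respect to the Haar measure of `X`, of `x ↦ ∫ f(yx) dμ(y)`. Convolving `μ`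
on the right by `ν` lowers the energy by a variance, so if no energy is lost and `1` lies in the
support of `ν`, then `∫ f(yz) dμ(y) = ∫ f dμ` for `ν`-almost every `z` (`ae_translateAverage_eq`).
In a minimal closed right ideal of `S` the energy of every `f` is constant. Hence for `μ` in such an
ideal, the closed invariant subgroup `Y` of all `z` with `μ * δ_z = μ` has full measure for every
`ν ∈ S` whose support contains `1` (`exists_forall_rightStabilizer_mem_ae`).

* The law of `x⁻¹y` for `x`, `y` independent of law `μ` lies in `S`, is invariant under left
  translation by `Y`, and is carried by `Y`. So it is `m_Y`, and `G ↷ (Y, m_Y)` is weakly contained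
  in `C`.
* If `G ↷ (Z, m_Z)` is weakly contained in `C`, then `m_Z ∈ S` has `1` in its support, so `Z ≤ Y`.
* If `Θ` is equivariant on an action weakly contained in `C`, then `Θ(z)⁻¹Θ(w) ∈ Y` almost surely,
  so `Θ` takes its values in a single coset of `Y`. Conversely, ergodicity relative to `X/Z`,
  applied to the inclusion of `Y`, puts `Y` in a single coset of `Z`, that is, `Y ≤ Z`.

For Bernoulli shifts, every standard Borel probability space is an image of the unit interval, so
weak containment in some Bernoulli shift is weak containment in the one with base `[0,1]`
(`weaklyContainedInBernoulli_iff`), and this one-element class is weakly closed under products.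
-/

/-! ### Laws of observables and weak containment -/

/-- The laws of two maps to a finite set differ in `ℓ¹` by at most twice the probability that the
maps differ. -/
theorem MeasureTheory.sum_abs_measureReal_preimage_sub_le {Ω P : Type*} [MeasurableSpace Ω]
    [Fintype P] (μ : Measure Ω) [IsFiniteMeasure μ] {f f' : Ω → P}
    (hf : ∀ p, MeasurableSet (f ⁻¹' {p})) (hf' : ∀ p, MeasurableSet (f' ⁻¹' {p})) :
    ∑ p, |μ.real (f ⁻¹' {p}) - μ.real (f' ⁻¹' {p})| ≤ 2 * μ.real {x | f x ≠ f' x} := by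
  set D : Set Ω := {x | f x ≠ f' x} with hD
  have hDm : MeasurableSet D := by
    have : D = (⋃ p, f ⁻¹' {p} ∩ f' ⁻¹' {p})ᶜ := by
      ext x; simp [hD, eq_comm]
    rw [this]
    exact (MeasurableSet.iUnion fun p => (hf p).inter (hf' p)).compl
  have hsum : ∀ h : Ω → P, (∀ p, MeasurableSet (h ⁻¹' {p})) →
      ∑ p, μ.real (h ⁻¹' {p} ∩ D) = μ.real D := by
    intro h hh
    have := sum_measureReal_preimage_singleton (μ := μ.restrict D) Finset.univ (f := h)
      (fun p _ => hh p)
    simpa [measureReal_restrict_apply, hh] using this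
  have hterm : ∀ p, |μ.real (f ⁻¹' {p}) - μ.real (f' ⁻¹' {p})| ≤
      μ.real (f ⁻¹' {p} ∩ D) + μ.real (f' ⁻¹' {p} ∩ D) := by
    intro p
    have h1 := measureReal_inter_add_sdiff (μ := μ) (s := f ⁻¹' {p}) hDm
    have h2 := measureReal_inter_add_sdiff (μ := μ) (s := f' ⁻¹' {p}) hDm
    have h3 : f ⁻¹' {p} \ D = f' ⁻¹' {p} \ D := by
      ext x; simp only [hD, Set.mem_sdiff, Set.mem_preimage, Set.mem_singleton_iff,
        Set.mem_ofPred_eq, not_not]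
      constructor <;> rintro ⟨h, h'⟩ <;> simp_all
    rw [← h1, ← h2, h3, add_sub_add_right_eq_sub]
    have := measureReal_nonneg (μ := μ) (s := f ⁻¹' {p} ∩ D)
    have := measureReal_nonneg (μ := μ) (s := f' ⁻¹' {p} ∩ D)
    rw [abs_le]; constructor <;> linarith
  calc _ ≤ ∑ p, (μ.real (f ⁻¹' {p} ∩ D) + μ.real (f' ⁻¹' {p} ∩ D)) :=
        Finset.sum_le_sum fun p _ => hterm p
    _ = _ := by rw [Finset.sum_add_distrib, hsum f hf, hsum f' hf', two_mul]

theorem Finset.sum_abs_mul_sub_mul_le {P Q : Type*} [Fintype P] [Fintype Q] (u u' : P → ℝ)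
    (v v' : Q → ℝ) (hv : ∑ q, |v q| ≤ 1) (hu' : ∑ p, |u' p| ≤ 1) :
    ∑ r : P × Q, |u r.1 * v r.2 - u' r.1 * v' r.2| ≤
      ∑ p, |u p - u' p| + ∑ q, |v q - v' q| := by
  have h : ∀ r : P × Q, |u r.1 * v r.2 - u' r.1 * v' r.2| ≤
      |u r.1 - u' r.1| * |v r.2| + |u' r.1| * |v r.2 - v' r.2| := by
    intro r
    rw [← abs_mul, ← abs_mul]
    refine le_trans (le_of_eq ?_) (abs_add_le _ _)
    congr 1; ring
  refine (Finset.sum_le_sum fun r _ => h r).trans ?_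
  rw [Finset.sum_add_distrib, Fintype.sum_prod_type, Fintype.sum_prod_type]
  simp only [← Finset.mul_sum, ← Finset.sum_mul]
  have h1 : 0 ≤ ∑ p, |u p - u' p| := Finset.sum_nonneg fun _ _ => abs_nonneg _
  have h2 : 0 ≤ ∑ q, |v q - v' q| := Finset.sum_nonneg fun _ _ => abs_nonneg _
  nlinarith

theorem Finset.sum_abs_fiber_sub_le {P Q : Type*} [Fintype P] [DecidableEq P] [Fintype Q]
    (φ : Q → P) (u v : Q → ℝ) :
    ∑ p, |∑ q with φ q = p, u q - ∑ q with φ q = p, v q| ≤ ∑ q, |u q - v q| := by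
  rw [← Finset.sum_fiberwise (s := Finset.univ) φ (fun q => |u q - v q|)]
  refine Finset.sum_le_sum fun p _ => ?_
  rw [← Finset.sum_sub_distrib]
  exact Finset.abs_sum_le_sum_abs _ _

open Classical in
/-- Recover a point of `A` from a predicate meant to single it out; the value is arbitrary unless
exactly one point satisfies the predicate. -/
noncomputable def decode {A : Type*} [Nonempty A] (T : A → Prop) : A :=
  if h : ∃ a, T a then h.choose else Classical.arbitrary A

/-- If each level set `α⁻¹{a}` is close to `R a`, then `α` is close in measure to the map decoded
from the family `R`: off the sets `R a ∆ α⁻¹{a}`, the only `R a` containing `x` is `R (α x)`. -/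
theorem MeasureTheory.measureReal_ne_decode_le {Ω A : Type*} [MeasurableSpace Ω] [Fintype A]
    [Nonempty A] (μ : Measure Ω) [IsFiniteMeasure μ] (α : Ω → A) (R : A → Set Ω) :
    μ.real {x | α x ≠ decode fun a => x ∈ R a} ≤ ∑ a, μ.real (symmDiff (R a) (α ⁻¹' {a})) := by
  have hsub : {x | α x ≠ decode fun a => x ∈ R a} ⊆ ⋃ a, symmDiff (R a) (α ⁻¹' {a}) := by
    intro x hx
    by_contra hno
    simp only [Set.mem_iUnion, not_exists, Set.mem_symmDiff, Set.mem_preimage,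
      Set.mem_singleton_iff] at hno
    have hiff : ∀ a, x ∈ R a ↔ α x = a := fun a => by have := hno a; tauto
    have hex : ∃ a, x ∈ R a := ⟨α x, (hiff _).2 rfl⟩
    refine hx ?_
    rw [decode, dif_pos hex]
    exact (hiff _).1 hex.choose_spec
  exact (measureReal_mono hsub).trans (measureReal_iUnion_fintype_le _)

/-- Measurable level sets may be approximated one at a time, by members of a generating ring. -/
theorem MeasureTheory.exists_measureReal_ne_decode_lt {Ω A : Type*} [m : MeasurableSpace Ω]
    [Finite A] [Nonempty A] (μ : Measure Ω) [IsFiniteMeasure μ] {𝓡 : Set (Set Ω)}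
    (h𝓡 : IsSetRing 𝓡) (huniv : Set.univ ∈ 𝓡) (hgen : m = MeasurableSpace.generateFrom 𝓡)
    {α : Ω → A} (hα : Measurable[_, ⊤] α) {ε : ℝ} (hε : 0 < ε) :
    ∃ R : A → Set Ω, (∀ a, R a ∈ 𝓡) ∧ μ.real {x | α x ≠ decode fun a => x ∈ R a} < ε := by
  cases nonempty_fintype A
  set δ : ℝ := ε / (Fintype.card A + 1) with hδ
  have hδ0 : 0 < δ := by positivity
  have happ : ∀ a, ∃ R ∈ 𝓡, μ.real (symmDiff R (α ⁻¹' {a})) < δ := by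
    intro a
    obtain ⟨R, hR, h⟩ := exists_measure_symmDiff_lt_of_generateFrom_isSetRing (μ := μ) h𝓡
      ⟨{Set.univ}, by simp, by simpa, by simp⟩ hgen (hα (t := {a}) trivial)
      (ENNReal.ofReal_pos.2 hδ0)
    exact ⟨R, hR, (ENNReal.lt_ofReal_iff_toReal_lt (measure_ne_top _ _)).1 h⟩
  choose R hR hlt using happ
  refine ⟨R, hR, ?_⟩
  calc _ ≤ ∑ a, μ.real (symmDiff (R a) (α ⁻¹' {a})) := measureReal_ne_decode_le μ α R
    _ ≤ ∑ _a : A, δ := Finset.sum_le_sum fun a _ => (hlt a).le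
    _ < ε := by
        rw [Finset.sum_const, Finset.card_univ, nsmul_eq_mul, hδ, ← mul_div_assoc,
          div_lt_iff₀ (by positivity)]
        linarith

namespace PMPAction

variable {G : Type u} [Group G]

theorem measurableSet_itinerary_preimage (a : PMPAction G) {A : Type} {α : a.carrier → A}
    (hα : Measurable[_, ⊤] α) (F : Finset G) (p : F → A) :
    MeasurableSet (a.itinerary α F ⁻¹' {p}) := by
  have : a.itinerary α F ⁻¹' {p} =
      ⋂ g : F, (fun x : a.carrier => (g : G)⁻¹ • x) ⁻¹' (α ⁻¹' {p g}) := by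
    ext x; simp [itinerary, funext_iff]
  rw [this]
  exact MeasurableSet.iInter fun g => (a.measurePreserving_smul _).measurable (hα trivial)

open Classical in
theorem sum_abs_law (a : PMPAction G) {A : Type} [Fintype A] {α : a.carrier → A}
    (hα : Measurable[_, ⊤] α) (F : Finset G) : ∑ p, |a.law α F p| = 1 := by
  have h := sum_measureReal_preimage_singleton (μ := a.measure) Finset.univ
    (f := a.itinerary α F) (fun p _ => a.measurableSet_itinerary_preimage hα F p)
  simp only [Finset.coe_univ, Set.preimage_univ, probReal_univ] at h
  rw [← h]
  exact Finset.sum_congr rfl fun p _ => abs_of_nonneg measureReal_nonneg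

open Classical in
/-- Changing an observable on a set of measure `δ` moves the law of its `F`-itinerary by at most
`2|F|δ`, because the itineraries differ only on the `F`-translates of that set. -/
theorem sum_abs_law_sub_law_le (a : PMPAction G) {A : Type} [Fintype A] {α α' : a.carrier → A}
    (hα : Measurable[_, ⊤] α) (hα' : Measurable[_, ⊤] α') (F : Finset G) :
    ∑ p, |a.law α F p - a.law α' F p| ≤ 2 * (F.card * a.measure.real {x | α x ≠ α' x}) := by
  refine (sum_abs_measureReal_preimage_sub_le a.measure
    (a.measurableSet_itinerary_preimage hα F)
    (a.measurableSet_itinerary_preimage hα' F)).trans ?_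
  have hD : MeasurableSet {x | α x ≠ α' x} := by
    have : {x | α x ≠ α' x} = ⋃ p, α ⁻¹' {p} ∩ α' ⁻¹' {p}ᶜ := by
      ext x; simp [eq_comm]
    rw [this]
    exact MeasurableSet.iUnion fun p => (hα trivial).inter (hα' trivial)
  gcongr
  have hsub : {x | a.itinerary α F x ≠ a.itinerary α' F x} ⊆
      ⋃ g : F, (fun x : a.carrier => (g : G)⁻¹ • x) ⁻¹' {x | α x ≠ α' x} := by
    intro x hx
    by_contra h
    refine hx (funext fun g => ?_)
    simp only [Set.mem_iUnion, not_exists, Set.mem_preimage, Set.mem_ofPred_eq, not_not] at h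
    exact h g
  calc _ ≤ a.measure.real (⋃ g : F, (fun x : a.carrier => (g : G)⁻¹ • x) ⁻¹' {x | α x ≠ α' x}) :=
        measureReal_mono hsub
    _ ≤ ∑ g : F, a.measure.real ((fun x : a.carrier => (g : G)⁻¹ • x) ⁻¹' {x | α x ≠ α' x}) :=
        measureReal_iUnion_fintype_le _
    _ = ∑ g : F, a.measure.real {x | α x ≠ α' x} :=
        Finset.sum_congr rfl fun g _ =>
          (a.measurePreserving_smul _).measureReal_preimage hD.nullMeasurableSet
    _ = _ := by simp

theorem WeaklyContained.trans {a : PMPAction G} {C D : Set (PMPAction G)}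
    (h : a.WeaklyContained D) (hDC : ∀ d ∈ D, d.WeaklyContained C) : a.WeaklyContained C := by
  classical
  intro ε hε F A _ α hα
  obtain ⟨d, hd, γ, hγ, h1⟩ := h (ε / 2) (by positivity) F A α hα
  obtain ⟨c, hc, β, hβ, h2⟩ := hDC d hd (ε / 2) (by positivity) F A γ hγ
  refine ⟨c, hc, β, hβ, ?_⟩
  calc _ ≤ ∑ p : F → A, (|a.law α F p - d.law γ F p| + |d.law γ F p - c.law β F p|) :=
        Finset.sum_le_sum fun p _ => abs_sub_le _ _ _
    _ < ε := by rw [Finset.sum_add_distrib]; linarith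

theorem weaklyContained_of_mem {a : PMPAction G} {C : Set (PMPAction G)} (h : a ∈ C) :
    a.WeaklyContained C := fun ε hε F A _ α hα => ⟨a, h, α, hα, by simpa⟩

/-- For weak containment it is enough to treat observables from a class that is dense for
convergence in measure. -/
theorem weaklyContained_of_approx {a : PMPAction G} {C : Set (PMPAction G)}
    (h : ∀ ε : ℝ, 0 < ε → ∀ (F : Finset G) (A : Type) [Fintype A] (α : a.carrier → A),
      Measurable[_, ⊤] α → ∃ α' : a.carrier → A, Measurable[_, ⊤] α' ∧
        a.measure.real {x | α x ≠ α' x} < ε ∧ ∃ b ∈ C, ∃ β : b.carrier → A, Measurable[_, ⊤] β ∧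
          (open Classical in ∑ p : F → A, |a.law α' F p - b.law β F p|) < ε) :
    a.WeaklyContained C := by
  classical
  intro ε hε F A _ α hα
  set δ : ℝ := ε / (2 * F.card + 1) with hδ
  have hδ0 : 0 < δ := by positivity
  obtain ⟨α', hα', h1, b, hb, β, hβ, h2⟩ := h δ hδ0 F A α hα
  refine ⟨b, hb, β, hβ, ?_⟩
  calc _ ≤ ∑ p : F → A, (|a.law α F p - a.law α' F p| + |a.law α' F p - b.law β F p|) :=
        Finset.sum_le_sum fun p _ => abs_sub_le _ _ _
    _ < 2 * (F.card * δ) + δ := by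
        rw [Finset.sum_add_distrib]
        refine add_lt_add_of_le_of_lt ((a.sum_abs_law_sub_law_le hα hα' F).trans ?_) h2
        gcongr
    _ = ε := by rw [hδ]; field_simp

/-- The law of an observable on a factor is the law of its pullback. -/
theorem law_comp (a b : PMPAction G) {Θ : a.carrier → b.carrier}
    (hΘ : MeasurePreserving Θ a.measure b.measure) (heq : ∀ (g : G) z, Θ (g • z) = g • Θ z)
    {A : Type} {α : b.carrier → A} (hα : Measurable[_, ⊤] α) (F : Finset G) (p : F → A) :
    a.law (α ∘ Θ) F p = b.law α F p := by
  have : a.itinerary (α ∘ Θ) F ⁻¹' {p} = Θ ⁻¹' (b.itinerary α F ⁻¹' {p}) := by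
    ext x; simp [itinerary, funext_iff, heq]
  rw [law, law, this, hΘ.measureReal_preimage
    (b.measurableSet_itinerary_preimage hα F p).nullMeasurableSet]

/-- A factor of an action is weakly contained in it. -/
theorem weaklyContained_singleton_of_factor (a b : PMPAction G) {Θ : a.carrier → b.carrier}
    (hΘ : MeasurePreserving Θ a.measure b.measure) (heq : ∀ (g : G) z, Θ (g • z) = g • Θ z) :
    b.WeaklyContained {a} := by
  intro ε hε F A _ α hα
  refine ⟨a, rfl, α ∘ Θ, fun s hs => hΘ.measurable (hα hs), ?_⟩
  simpa [law_comp a b hΘ heq hα] using hε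

theorem WeaklyContained.of_factor {a b : PMPAction G} {C : Set (PMPAction G)}
    (ha : a.WeaklyContained C) {Θ : a.carrier → b.carrier}
    (hΘ : MeasurePreserving Θ a.measure b.measure) (heq : ∀ (g : G) z, Θ (g • z) = g • Θ z) :
    b.WeaklyContained C :=
  (weaklyContained_singleton_of_factor a b hΘ heq).trans fun _ hd => hd ▸ ha

end PMPAction

/-! ### Products of actions -/

theorem measurable_top_of_fiber {Ω A : Type*} [MeasurableSpace Ω] [Countable A] {α : Ω → A}
    (h : ∀ a, MeasurableSet (α ⁻¹' {a})) : Measurable[_, ⊤] α :=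
  @measurable_to_countable' A Ω ⊤ _ _ α h

theorem measurable_top_pi {Ω ι : Type*} {B : ι → Type*} [MeasurableSpace Ω] [Finite ι]
    [∀ i, Finite (B i)] {β : ∀ i, Ω → B i} (h : ∀ i, Measurable[_, ⊤] (β i)) :
    Measurable[_, ⊤] (fun x i => β i x) := by
  refine measurable_top_of_fiber fun b => ?_
  have : (fun x i => β i x) ⁻¹' {b} = ⋂ i, β i ⁻¹' {b i} := by
    ext x; simp [funext_iff]
  rw [this]
  exact MeasurableSet.iInter fun i => h i trivial

theorem measurable_top_prodMk {Ω B B' : Type*} [MeasurableSpace Ω] [Finite B] [Finite B']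
    {β : Ω → B} {γ : Ω → B'} (hβ : Measurable[_, ⊤] β) (hγ : Measurable[_, ⊤] γ) :
    Measurable[_, ⊤] (fun x => (β x, γ x)) := by
  refine measurable_top_of_fiber fun b => ?_
  have : (fun x => (β x, γ x)) ⁻¹' {b} = β ⁻¹' {b.1} ∩ γ ⁻¹' {b.2} := by
    ext x; simp [Prod.ext_iff]
  rw [this]
  exact (hβ trivial).inter (hγ trivial)

theorem measurable_top_prodMap {Ω Ω' B B' : Type*} [MeasurableSpace Ω] [MeasurableSpace Ω']
    [Finite B] [Finite B'] {β : Ω → B} {γ : Ω' → B'} (hβ : Measurable[_, ⊤] β)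
    (hγ : Measurable[_, ⊤] γ) : Measurable[_, ⊤] (Prod.map β γ) :=
  measurable_top_prodMk (fun _ hs => measurable_fst (hβ hs)) (fun _ hs => measurable_snd (hγ hs))

/-- The sets of a product space that are determined by a finite measurable partition of each
factor, i.e. the finite unions of measurable rectangles. -/
def finiteRectangleUnions (Ω Ω' : Type*) [MeasurableSpace Ω] [MeasurableSpace Ω'] :
    Set (Set (Ω × Ω')) :=
  {S | ∃ (B B' : Type) (_ : Finite B) (_ : Finite B') (β : Ω → B) (γ : Ω' → B') (T : Set (B × B')),
    Measurable[_, ⊤] β ∧ Measurable[_, ⊤] γ ∧ Prod.map β γ ⁻¹' T = S}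

theorem finiteRectangleUnions.op_mem {Ω Ω' : Type*} [MeasurableSpace Ω] [MeasurableSpace Ω']
    (op : Prop → Prop → Prop) {S S' : Set (Ω × Ω')} (hS : S ∈ finiteRectangleUnions Ω Ω')
    (hS' : S' ∈ finiteRectangleUnions Ω Ω') :
    {x | op (x ∈ S) (x ∈ S')} ∈ finiteRectangleUnions Ω Ω' := by
  obtain ⟨B, B', _, _, β, γ, T, hβ, hγ, rfl⟩ := hS
  obtain ⟨E, E', _, _, δ, κ, T', hδ, hκ, rfl⟩ := hS'
  exact ⟨B × E, B' × E', inferInstance, inferInstance, fun x => (β x, δ x), fun x => (γ x, κ x),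
    {r | op ((r.1.1, r.2.1) ∈ T) ((r.1.2, r.2.2) ∈ T')}, measurable_top_prodMk hβ hδ,
    measurable_top_prodMk hγ hκ, rfl⟩

theorem univ_mem_finiteRectangleUnions {Ω Ω' : Type*} [MeasurableSpace Ω] [MeasurableSpace Ω'] :
    Set.univ ∈ finiteRectangleUnions Ω Ω' :=
  ⟨Unit, Unit, inferInstance, inferInstance, fun _ => (), fun _ => (), Set.univ,
    measurable_top_of_fiber (by simp), measurable_top_of_fiber (by simp), by simp⟩

theorem isSetRing_finiteRectangleUnions (Ω Ω' : Type*) [MeasurableSpace Ω] [MeasurableSpace Ω'] :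
    IsSetRing (finiteRectangleUnions Ω Ω') where
  empty_mem := by
    simpa using finiteRectangleUnions.op_mem (fun _ _ => False)
      (univ_mem_finiteRectangleUnions (Ω := Ω) (Ω' := Ω')) univ_mem_finiteRectangleUnions
  union_mem _ _ hs ht := finiteRectangleUnions.op_mem (· ∨ ·) hs ht
  sdiff_mem _ _ hs ht := finiteRectangleUnions.op_mem (fun p q => p ∧ ¬ q) hs ht

theorem generateFrom_finiteRectangleUnions (Ω Ω' : Type*) [MeasurableSpace Ω]
    [MeasurableSpace Ω'] :
    (inferInstance : MeasurableSpace (Ω × Ω')) =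
      MeasurableSpace.generateFrom (finiteRectangleUnions Ω Ω') := by
  apply le_antisymm
  · rw [← generateFrom_prod]
    refine MeasurableSpace.generateFrom_mono ?_
    rintro _ ⟨s, hs, t, ht, rfl⟩
    refine ⟨Prop, Prop, inferInstance, inferInstance, (· ∈ s), (· ∈ t), {r | r.1 ∧ r.2},
      ?_, ?_, rfl⟩
    · exact hs.mem.mono le_rfl le_top |>.mono le_rfl (by rfl)
    · exact ht.mem
  · refine MeasurableSpace.generateFrom_le ?_
    rintro _ ⟨B, B', _, _, β, γ, T, hβ, hγ, rfl⟩
    exact measurable_top_prodMap hβ hγ trivial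

/-- A finite observable on a product space is approximated in measure by observables depending
only on finite observables of the factors. -/
theorem exists_prodMap_approx {Ω Ω' : Type*} [MeasurableSpace Ω] [MeasurableSpace Ω']
    (μ : Measure (Ω × Ω')) [IsFiniteMeasure μ] {A : Type} [Finite A] [Nonempty A]
    {α : Ω × Ω' → A} (hα : Measurable[_, ⊤] α) {ε : ℝ} (hε : 0 < ε) :
    ∃ (B B' : Type) (_ : Fintype B) (_ : Fintype B') (β : Ω → B) (γ : Ω' → B') (φ : B × B' → A),
      Measurable[_, ⊤] β ∧ Measurable[_, ⊤] γ ∧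
        μ.real {x | α x ≠ φ (Prod.map β γ x)} < ε := by
  obtain ⟨R, hR, hlt⟩ := exists_measureReal_ne_decode_lt μ
    (isSetRing_finiteRectangleUnions Ω Ω') univ_mem_finiteRectangleUnions
    (generateFrom_finiteRectangleUnions Ω Ω') hα hε
  choose B B' hB hB' β γ T hβ hγ hT using hR
  refine ⟨∀ a, B a, ∀ a, B' a, Fintype.ofFinite _, Fintype.ofFinite _, fun x a => β a x,
    fun x a => γ a x, fun r => decode fun a => (r.1 a, r.2 a) ∈ T a,
    measurable_top_pi hβ, measurable_top_pi hγ, ?_⟩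
  convert hlt using 8 with x a
  rw [← hT]
  rfl

namespace PMPAction

variable {G : Type u} [Group G]

open Classical in
theorem law_prod (a b : PMPAction G) {A B B' : Type} [Fintype B] [Fintype B']
    {β : a.carrier → B} {γ : b.carrier → B'} (hβ : Measurable[_, ⊤] β) (hγ : Measurable[_, ⊤] γ)
    (φ : B × B' → A) (F : Finset G) (p : F → A) :
    (a.prod b).law (fun x => φ (Prod.map β γ x)) F p =
      ∑ r : (F → B) × (F → B') with (fun g => φ (r.1 g, r.2 g)) = p,
        a.law β F r.1 * b.law γ F r.2 := by
  have hset : {x : a.carrier × b.carrier |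
        (fun g : F => φ (β ((g : G)⁻¹ • x.1), γ ((g : G)⁻¹ • x.2))) = p} =
      ⋃ r ∈ Finset.univ.filter (fun r : (F → B) × (F → B') => (fun g => φ (r.1 g, r.2 g)) = p),
        (a.itinerary β F ⁻¹' {r.1}) ×ˢ (b.itinerary γ F ⁻¹' {r.2}) := by
    refine Set.ext fun x => ?_
    rw [Set.mem_iUnion₂]
    constructor
    · intro h
      exact ⟨(a.itinerary β F x.1, b.itinerary γ F x.2),
        Finset.mem_filter.2 ⟨Finset.mem_univ _, h⟩, rfl, rfl⟩
    · rintro ⟨r, h, h1, h2⟩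
      rw [← (Finset.mem_filter.1 h).2, ← show _ = r.1 from h1, ← show _ = r.2 from h2]
      rfl
  have := measureReal_biUnion_finset (μ := a.measure.prod b.measure)
    (s := Finset.univ.filter (fun r : (F → B) × (F → B') => (fun g => φ (r.1 g, r.2 g)) = p))
    (f := fun r => (a.itinerary β F ⁻¹' {r.1}) ×ˢ (b.itinerary γ F ⁻¹' {r.2}))
    (by
      intro r _ r' _ hrr
      refine Set.disjoint_left.2 fun x hx hx' => hrr ?_
      exact Prod.ext (hx.1.symm.trans hx'.1) (hx.2.symm.trans hx'.2))
    (fun r _ => (a.measurableSet_itinerary_preimage hβ F _).prod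
      (b.measurableSet_itinerary_preimage hγ F _))
  change (a.measure.prod b.measure).real {x : a.carrier × b.carrier |
    (fun g : F => φ (β ((g : G)⁻¹ • x.1), γ ((g : G)⁻¹ • x.2))) = p} = _
  rw [hset]
  exact this.trans (Finset.sum_congr rfl fun r _ => measureReal_prod_prod _ _)

/-- The actions weakly contained in a class that is weakly closed under products are closed under
products: approximate an observable of the product by one depending on finite observables of the
factors, then approximate each of these separately. -/
theorem WeaklyContained.prod {a b : PMPAction G} {C : Set (PMPAction G)}
    (hC : WeaklyClosedUnderProducts C) (ha : a.WeaklyContained C) (hb : b.WeaklyContained C) :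
    (a.prod b).WeaklyContained C := by
  classical
  suffices h : (a.prod b).WeaklyContained {e | ∃ c ∈ C, ∃ d ∈ C, e = c.prod d} by
    refine h.trans ?_
    rintro _ ⟨c, hc, d, hd, rfl⟩
    exact hC c hc d hd
  refine weaklyContained_of_approx fun ε hε F A _ α hα => ?_
  have : Nonempty A := ⟨α (nonempty_of_isProbabilityMeasure (a.prod b).measure).some⟩
  obtain ⟨B, B', _, _, β, γ, φ, hβ, hγ, hlt⟩ :=
    exists_prodMap_approx (a.measure.prod b.measure) hα hε
  obtain ⟨c, hc, β', hβ', h1⟩ := ha (ε / 2) (by positivity) F B β hβ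
  obtain ⟨d, hd, γ', hγ', h2⟩ := hb (ε / 2) (by positivity) F B' γ hγ
  have hm : Measurable[_, ⊤] (fun x : (a.prod b).carrier => φ (Prod.map β γ x)) :=
    fun s _ => measurable_top_prodMap hβ hγ (show MeasurableSet[⊤] (φ ⁻¹' s) from trivial)
  have hm' : Measurable[_, ⊤] (fun x : (c.prod d).carrier => φ (Prod.map β' γ' x)) :=
    fun s _ => measurable_top_prodMap hβ' hγ' (show MeasurableSet[⊤] (φ ⁻¹' s) from trivial)
  have hlaw : ∑ p : F → A, |(a.prod b).law (fun x => φ (Prod.map β γ x)) F p -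
      (c.prod d).law (fun x => φ (Prod.map β' γ' x)) F p| < ε := by
    calc _ = _ := Finset.sum_congr rfl fun p _ => by
            rw [law_prod a b hβ hγ, law_prod c d hβ' hγ']
      _ ≤ _ := Finset.sum_abs_fiber_sub_le
            (fun r : (F → B) × (F → B') => fun g => φ (r.1 g, r.2 g))
            (fun r => a.law β F r.1 * b.law γ F r.2) (fun r => c.law β' F r.1 * d.law γ' F r.2)
      _ ≤ _ := Finset.sum_abs_mul_sub_mul_le _ _ _ _ (b.sum_abs_law hγ F).le
            (c.sum_abs_law hβ' F).le
      _ < ε := by linarith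
  exact ⟨fun x => φ (Prod.map β γ x), hm, hlt, c.prod d, ⟨c, hc, d, hd, rfl⟩,
    fun x => φ (Prod.map β' γ' x), hm', hlaw⟩

/-! ### A universal Bernoulli shift -/

/-- A measure-preserving map between base spaces induces a factor map of Bernoulli shifts. -/
theorem weaklyContained_bernoulli_of_map {B B' : Type u} [MeasurableSpace B] [MeasurableSpace B']
    {β : Measure B} {β' : Measure B'} [IsProbabilityMeasure β] [IsProbabilityMeasure β']
    {f : B → B'} (hf : MeasurePreserving f β β') :
    (bernoulli G B' β').WeaklyContained {bernoulli G B β} := by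
  refine weaklyContained_singleton_of_factor (bernoulli G B β) (bernoulli G B' β')
    (Θ := fun (x : G → B) (h : G) => f (x h)) ⟨?_, ?_⟩ (fun g z => rfl)
  · change Measurable fun (x : G → B) (h : G) => f (x h)
    have := hf.measurable
    fun_prop
  · obtain ⟨hfm, rfl⟩ := hf
    exact Measure.infinitePi_map_pi (μ := fun _ : G => β) (f := fun _ => f) (fun _ => hfm)

/-- An i.i.d. family of pairs with independent entries is a pair of independent i.i.d. families. -/
theorem map_infinitePi_prod {ι B B' : Type*} [MeasurableSpace B] [MeasurableSpace B']
    (β : Measure B) (β' : Measure B') [IsProbabilityMeasure β] [IsProbabilityMeasure β'] :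
    (Measure.infinitePi fun _ : ι => β.prod β').map
        (fun x => ((fun i => (x i).1, fun i => (x i).2) : (ι → B) × (ι → B'))) =
      (Measure.infinitePi fun _ : ι => β).prod (Measure.infinitePi fun _ : ι => β') := by
  classical
  refine (Measure.prod_eq_generateFrom
    (C := squareCylinders fun _ : ι => {s : Set B | MeasurableSet s})
    (D := squareCylinders fun _ : ι => {s : Set B' | MeasurableSet s})
    generateFrom_squareCylinders generateFrom_squareCylinders
    (isPiSystem_squareCylinders (fun _ => MeasurableSpace.isPiSystem_measurableSet) (by simp))
    (isPiSystem_squareCylinders (fun _ => MeasurableSpace.isPiSystem_measurableSet) (by simp))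
    ⟨fun _ => Set.univ, fun _ => ⟨∅, fun _ => Set.univ, by simp, by simp⟩, by simp,
      Set.iUnion_const _⟩
    ⟨fun _ => Set.univ, fun _ => ⟨∅, fun _ => Set.univ, by simp, by simp⟩, by simp,
      Set.iUnion_const _⟩ ?_).symm
  rintro _ ⟨s, t, ht, rfl⟩ _ ⟨s', t', ht', rfl⟩
  replace ht : ∀ i, MeasurableSet (t i) := fun i => ht i trivial
  replace ht' : ∀ i, MeasurableSet (t' i) := fun i => ht' i trivial
  rw [Measure.map_apply (by fun_prop) ((MeasurableSet.pi s.countable_toSet fun i _ => ht i).prod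
    (MeasurableSet.pi s'.countable_toSet fun i _ => ht' i))]
  let u : ι → Set B := fun i => if i ∈ s then t i else Set.univ
  let u' : ι → Set B' := fun i => if i ∈ s' then t' i else Set.univ
  have hu : ∀ i, MeasurableSet (u i) := fun i => by
    simp only [u]; split_ifs <;> simp [ht]
  have hu' : ∀ i, MeasurableSet (u' i) := fun i => by
    simp only [u']; split_ifs <;> simp [ht']
  have hpre : (fun x : ι → B × B' => ((fun i => (x i).1, fun i => (x i).2) : (ι → B) × (ι → B')))
      ⁻¹' ((s : Set ι).pi t ×ˢ (s' : Set ι).pi t') =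
      ((s ∪ s' : Finset ι) : Set ι).pi fun i => u i ×ˢ u' i := by
    ext x
    simp only [Set.mem_preimage, Set.mem_prod, Set.mem_pi, Finset.mem_coe, Finset.mem_union, u, u']
    constructor
    · rintro ⟨h, h'⟩ i -
      constructor
      · split_ifs with hi
        · exact h i hi
        · trivial
      · split_ifs with hi
        · exact h' i hi
        · trivial
    · intro h
      refine ⟨fun i hi => ?_, fun i hi => ?_⟩
      · simpa [hi] using (h i (Or.inl hi)).1
      · simpa [hi] using (h i (Or.inr hi)).2
  rw [hpre, Measure.infinitePi_pi _ fun i _ => (hu i).prod (hu' i),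
    Measure.infinitePi_pi _ fun i _ => ht i, Measure.infinitePi_pi _ fun i _ => ht' i]
  simp only [Measure.prod_prod]
  rw [Finset.prod_mul_distrib]
  congr 1
  · rw [← Finset.prod_subset (s₁ := s) Finset.subset_union_left fun i _ hi => by simp [u, hi]]
    exact Finset.prod_congr rfl fun i hi => by simp [u, hi]
  · rw [← Finset.prod_subset (s₁ := s') Finset.subset_union_right fun i _ hi => by simp [u', hi]]
    exact Finset.prod_congr rfl fun i hi => by simp [u', hi]

theorem _root_.standardBorelSpace_ulift (B : Type*) [MeasurableSpace B] [h : StandardBorelSpace B] :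
    StandardBorelSpace (ULift.{u} B) := by
  obtain ⟨τ, hb, hp⟩ := h.polish
  let : TopologicalSpace (ULift.{u} B) := τ.induced ULift.down
  have hemb : Topology.IsClosedEmbedding (ULift.down : ULift.{u} B → B) :=
    ⟨⟨⟨rfl⟩, ULift.down_injective⟩, by simp [ULift.down_surjective.range_eq]⟩
  refine ⟨⟨_, ⟨?_⟩, hemb.polishSpace⟩⟩
  rw [borel_comap, ← hb.measurable_eq]
  exact MeasurableEquiv.ulift.measurableEmbedding.comap_eq.symm

/-- The unit interval with Lebesgue measure, in the universe `u`. Every standard Borel probability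
space is its image under a measure-preserving map. -/
noncomputable def uniformULift : Measure (ULift.{u} unitInterval) :=
  (volume : Measure unitInterval).map ULift.up

instance : IsProbabilityMeasure uniformULift.{u} :=
  Measure.isProbabilityMeasure_map measurable_up.aemeasurable

theorem exists_measurePreserving_uniformULift {B : Type u} [MeasurableSpace B]
    [StandardBorelSpace B] (β : Measure B) [IsProbabilityMeasure β] :
    ∃ f : ULift.{u} unitInterval → B, MeasurePreserving f uniformULift β := by
  have : Nonempty B := nonempty_of_isProbabilityMeasure β
  obtain ⟨f, hf, rfl⟩ := β.exists_measurable_map_eq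
  refine ⟨f ∘ ULift.down, hf.comp measurable_down, ?_⟩
  rw [uniformULift, Measure.map_map (hf.comp measurable_down) measurable_up]
  rfl

theorem weaklyContainedInBernoulli_iff (a : PMPAction G) :
    a.WeaklyContainedInBernoulli ↔
      a.WeaklyContained {bernoulli G (ULift.{u} unitInterval) uniformULift} := by
  have hst : StandardBorelSpace (ULift.{u} unitInterval) := standardBorelSpace_ulift _
  refine ⟨?_, fun h => ⟨_, _, hst, _, _, h⟩⟩
  rintro ⟨B, _, _, β, _, h⟩
  obtain ⟨f, hf⟩ := exists_measurePreserving_uniformULift β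
  refine h.trans ?_
  rintro _ rfl
  exact weaklyContained_bernoulli_of_map hf

/-- The square of the Bernoulli shift with base `[0,1]` is the Bernoulli shift with base
`[0,1]²`, which is a factor of the one with base `[0,1]`. -/
theorem weaklyClosedUnderProducts_bernoulli :
    WeaklyClosedUnderProducts {bernoulli G (ULift.{u} unitInterval) uniformULift} := by
  have hst : StandardBorelSpace (ULift.{u} unitInterval) := standardBorelSpace_ulift _
  rintro _ rfl _ rfl
  obtain ⟨f, hf⟩ := exists_measurePreserving_uniformULift (uniformULift.{u}.prod uniformULift.{u})
  refine (weaklyContained_bernoulli_of_map hf).of_factor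
    (Θ := fun x => ((fun i => (x i).1, fun i => (x i).2) :
      (G → ULift.{u} unitInterval) × (G → ULift.{u} unitInterval))) ⟨?_, ?_⟩ fun g z => rfl
  · change Measurable fun x : G → ULift.{u} unitInterval × ULift.{u} unitInterval =>
      ((fun i => (x i).1, fun i => (x i).2) :
        (G → ULift.{u} unitInterval) × (G → ULift.{u} unitInterval))
    fun_prop
  · exact map_infinitePi_prod uniformULift uniformULift

end PMPAction

/-! ### Weak-* limits of invariant measures -/

open Filter Topology

/-- The complement of the frontier of `S` consists of the points where membership in `S` is locally
constant. -/
theorem notMem_frontier_iff_eventually {X : Type*} [TopologicalSpace X] {S : Set X} {x : X} :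
    x ∉ frontier S ↔ ∀ᶠ y in 𝓝 x, (y ∈ S ↔ x ∈ S) := by
  rw [frontier_eq_closure_inter_closure, Set.mem_inter_iff, mem_closure_iff_frequently,
    mem_closure_iff_frequently, not_and_or, not_frequently, not_frequently]
  by_cases hx : x ∈ S
  · simp only [hx, iff_true, Set.mem_compl_iff, not_not, or_iff_right_iff_imp]
    intro h
    exact absurd hx h.self_of_nhds
  · simp only [hx, iff_false, Set.mem_compl_iff, not_not, or_iff_left_iff_imp]
    intro h
    exact absurd h.self_of_nhds hx

theorem frontier_setOf_op_subset {X : Type*} [TopologicalSpace X] (op : Prop → Prop → Prop)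
    (S T : Set X) : frontier {x | op (x ∈ S) (x ∈ T)} ⊆ frontier S ∪ frontier T := by
  intro x hx
  by_contra h
  simp only [Set.mem_union, not_or, notMem_frontier_iff_eventually] at h
  refine notMem_frontier_iff_eventually.2 ?_ hx
  filter_upwards [h.1, h.2] with y h1 h2
  simp only [h1, h2]

/-- The continuity sets of a measure: the measurable sets whose boundary is null. -/
def MeasureTheory.Measure.continuitySets {X : Type*} [TopologicalSpace X] [MeasurableSpace X]
    (μ : Measure X) : Set (Set X) :=
  {S | MeasurableSet S ∧ μ (frontier S) = 0}

theorem MeasureTheory.Measure.isSetRing_continuitySets {X : Type*} [TopologicalSpace X]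
    [MeasurableSpace X] (μ : Measure X) : IsSetRing μ.continuitySets where
  empty_mem := by simp [continuitySets]
  union_mem S T hS hT := ⟨hS.1.union hT.1, measure_mono_null
    (frontier_setOf_op_subset (· ∨ ·) S T) (measure_union_null hS.2 hT.2)⟩
  sdiff_mem S T hS hT := ⟨hS.1.diff hT.1, measure_mono_null
    (frontier_setOf_op_subset (fun p q => p ∧ ¬ q) S T) (measure_union_null hS.2 hT.2)⟩

/-- A closed set is the intersection of those of its thickenings that are continuity sets. -/
theorem MeasureTheory.Measure.generateFrom_continuitySets {X : Type*} [TopologicalSpace X]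
    [TopologicalSpace.MetrizableSpace X] [m : MeasurableSpace X] [BorelSpace X] (μ : Measure X)
    [SFinite μ] : m = MeasurableSpace.generateFrom μ.continuitySets := by
  let _ := TopologicalSpace.metrizableSpaceMetric X
  apply le_antisymm
  · refine (BorelSpace.measurable_eq (α := X)).trans_le ?_
    rw [borel_eq_generateFrom_isClosed]
    refine MeasurableSpace.generateFrom_le fun K hK => ?_
    obtain ⟨r, hr, hrK⟩ := exists_null_frontiers_thickening μ K
    have hKr : K = ⋂ n, Metric.thickening (r n) K := by
      refine subset_antisymm
        (Set.subset_iInter fun n => Metric.self_subset_thickening (hrK n).1 K) fun x hx => ?_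
      rw [← hK.closure_eq, Metric.closure_eq_iInter_thickening, Set.mem_iInter₂]
      intro δ hδ
      obtain ⟨n, hn⟩ := (hr.eventually_lt_const hδ).exists
      exact Metric.thickening_mono hn.le K (Set.mem_iInter.1 hx n)
    rw [hKr]
    exact MeasurableSet.iInter fun n => MeasurableSpace.measurableSet_generateFrom
      ⟨Metric.isOpen_thickening.measurableSet, (hrK n).2⟩
  · exact MeasurableSpace.generateFrom_le fun S hS => hS.1

namespace PMPAction

variable {G : Type u} [Group G]

/-- The action `G ↷ (X, μ)` given by an invariant probability measure. -/
def ofMeasure {X : Type u} [MeasurableSpace X] [MulAction G X] (μ : Measure X)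
    [IsProbabilityMeasure μ] (h : ∀ g : G, MeasurePreserving (fun x : X => g • x) μ μ) :
    PMPAction G where
  carrier := X
  measure := μ
  measurePreserving_smul := h

/-- The invariant probability measures `μ` on `X` for which `G ↷ (X, μ)` is weakly contained
in `C`. -/
def containedMeasures (C : Set (PMPAction G)) (X : Type u) [MeasurableSpace X] [MulAction G X] :
    Set (ProbabilityMeasure X) :=
  {μ | ∃ h : ∀ g : G, MeasurePreserving (fun x : X => g • x) (μ : Measure X) μ,
    (ofMeasure (μ : Measure X) h).WeaklyContained C}

variable {X : Type u} [TopologicalSpace X] [MeasurableSpace X] [BorelSpace X] [MulAction G X]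
  [ContinuousConstSMul G X]

/-- The itineraries of an observable decoded from continuity sets are continuity sets of any
invariant measure. -/
theorem measure_frontier_itinerary_decode {μ : Measure X}
    (h : ∀ g : G, MeasurePreserving (fun x : X => g • x) μ μ)
    {A : Type} [Finite A] [Nonempty A] {R : A → Set X} (hR : ∀ i, R i ∈ μ.continuitySets)
    (F : Finset G) (p : F → A) :
    μ (frontier {x | (fun g : F => decode fun i => (g : G)⁻¹ • x ∈ R i) = p}) = 0 := by
  have hsub : frontier {x | (fun g : F => decode fun i => (g : G)⁻¹ • x ∈ R i) = p} ⊆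
      ⋃ (g : F) (i : A), (fun x : X => (g : G)⁻¹ • x) ⁻¹' frontier (R i) := by
    intro x hx
    by_contra h
    simp only [Set.mem_iUnion, Set.mem_preimage, not_exists,
      notMem_frontier_iff_eventually] at h
    refine notMem_frontier_iff_eventually.2 ?_ hx
    have h' : ∀ᶠ y in 𝓝 x, ∀ (g : F) (i : A), (g : G)⁻¹ • y ∈ R i ↔ (g : G)⁻¹ • x ∈ R i :=
      eventually_all.2 fun g => eventually_all.2 fun i =>
        ((continuous_const_smul (g : G)⁻¹).tendsto x).eventually (h g i)
    filter_upwards [h'] with y hy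
    simp only [hy]
  refine measure_mono_null hsub (measure_iUnion_null fun g => measure_iUnion_null fun i => ?_)
  rw [(h _).measure_preimage isClosed_frontier.measurableSet.nullMeasurableSet]
  exact (hR i).2

variable [TopologicalSpace.MetrizableSpace X]

/-- A weak-* limit `μ` inherits weak containment in `C`: an observable decoded from continuity
sets of `μ` has nearly the same itinerary law under `μ` and under measures weak-* close to `μ`. -/
theorem isClosed_containedMeasures (C : Set (PMPAction G)) :
    IsClosed (containedMeasures C X) := by
  classical
  let _ := TopologicalSpace.metrizableSpaceMetric X
  refine isClosed_of_closure_subset fun μ hμ => ?_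
  have hinv : ∀ g : G, MeasurePreserving (fun x : X => g • x) (μ : Measure X) μ := by
    intro g
    have hg : Continuous fun x : X => g • x := continuous_const_smul g
    have hcl : IsClosed {ν : ProbabilityMeasure X | ν.map hg.measurable.aemeasurable = ν} :=
      isClosed_eq (ProbabilityMeasure.continuous_map hg) continuous_id
    have := closure_minimal (s := containedMeasures C X) (fun ν ⟨h, _⟩ => Subtype.ext (h g).map_eq)
      hcl hμ
    exact ⟨hg.measurable, congrArg ProbabilityMeasure.toMeasure this⟩
  refine ⟨hinv, weaklyContained_of_approx fun ε hε F A _ α hα => ?_⟩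
  have : Nonempty A := ⟨α (nonempty_of_isProbabilityMeasure (μ : Measure X)).some⟩
  obtain ⟨R, hR, hlt⟩ := exists_measureReal_ne_decode_lt (μ : Measure X)
    (μ : Measure X).isSetRing_continuitySets ⟨MeasurableSet.univ, by simp⟩
    (μ : Measure X).generateFrom_continuitySets hα hε
  set α' : X → A := fun x => decode fun i => x ∈ R i with hα'
  have hm : Measurable[_, ⊤] α' := by
    have h1 : Measurable[_, ⊤] fun (x : X) (i : A) => x ∈ R i :=
      measurable_top_pi fun i => measurable_top_of_fiber fun P => by
        by_cases hP : P
        · convert (hR i).1 using 1; ext; simp [hP]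
        · convert (hR i).1.compl using 1; ext; simp [hP]
    exact fun s _ => h1 (show MeasurableSet[⊤] (decode ⁻¹' s) from trivial)
  let E : (F → A) → Set X := fun p => {x | (fun g : F => α' ((g : G)⁻¹ • x)) = p}
  have hE : ∀ p, (μ : Measure X) (frontier (E p)) = 0 :=
    measure_frontier_itinerary_decode hinv hR F
  have htend : Tendsto (fun ν : ProbabilityMeasure X => ∑ p : F → A, |(μ (E p) : ℝ) - ν (E p)|)
      (𝓝 μ) (𝓝 0) := by
    have : ∀ p, Tendsto (fun ν : ProbabilityMeasure X => |(μ (E p) : ℝ) - ν (E p)|) (𝓝 μ)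
        (𝓝 0) := by
      intro p
      have h := ProbabilityMeasure.tendsto_measure_of_null_frontier_of_tendsto
        (μs := id) (L := 𝓝 μ) (μ := μ) tendsto_id (E := E p)
        ((ProbabilityMeasure.null_iff_toMeasure_null μ _).2 (hE p))
      have h' := (NNReal.tendsto_coe.2 h).const_sub (μ (E p) : ℝ)
      simpa using h'.abs
    simpa using tendsto_finsetSum Finset.univ fun p _ => this p
  obtain ⟨ν, ⟨hν, hνC⟩, hlt'⟩ :=
    ((mem_closure_iff_frequently.1 hμ).and_eventually
      (htend.eventually_lt_const (half_pos hε))).exists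
  obtain ⟨b, hb, β, hβ, hlt''⟩ := hνC (ε / 2) (half_pos hε) F A α' hm
  refine ⟨α', hm, hlt, b, hb, β, hβ, ?_⟩
  calc _ ≤ ∑ p : F → A, (|(ofMeasure (μ : Measure X) hinv).law α' F p -
          (ofMeasure (ν : Measure X) hν).law α' F p| +
          |(ofMeasure (ν : Measure X) hν).law α' F p - b.law β F p|) :=
        Finset.sum_le_sum fun p _ => abs_sub_le _ _ _
    _ < ε := by
        rw [Finset.sum_add_distrib, ← add_halves ε]
        exact add_lt_add hlt' hlt''

end PMPAction

/-! ### Energy and minimal right ideals -/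

section Integrals

variable {Y Z : Type*} [TopologicalSpace Y] [CompactSpace Y] [MeasurableSpace Y]
  [OpensMeasurableSpace Y]

theorem Continuous.integrable_of_compactSpace {f : Y → ℝ} (hf : Continuous f) (ν : Measure Y)
    [IsFiniteMeasure ν] : Integrable f ν := by
  obtain ⟨c, hc⟩ := isCompact_univ.exists_bound_of_continuousOn hf.continuousOn
  exact Integrable.of_bound hf.aestronglyMeasurable c (ae_of_all _ fun y => hc y trivial)

theorem continuous_integral_of_compactSpace [TopologicalSpace Z] [CompactSpace Z]
    [FirstCountableTopology Z] {f : Z → Y → ℝ} (hf : Continuous (Function.uncurry f))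
    (ν : Measure Y) [IsFiniteMeasure ν] : Continuous fun z => ∫ y, f z y ∂ν := by
  obtain ⟨c, hc⟩ := isCompact_univ.exists_bound_of_continuousOn hf.continuousOn
  exact continuous_of_dominated (bound := fun _ => c)
    (fun z => (hf.comp (Continuous.prodMk_right z)).aestronglyMeasurable)
    (fun z => ae_of_all _ fun y => hc (z, y) trivial) (integrable_const c)
    (ae_of_all _ fun y => hf.comp (Continuous.prodMk_left y))

end Integrals

section Energy

variable {X : Type*} [Group X] [TopologicalSpace X] [IsTopologicalGroup X] [CompactSpace X]
  [TopologicalSpace.MetrizableSpace X] [MeasurableSpace X] [BorelSpace X]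

/-- The average of `f` over left translates chosen according to `μ`. -/
noncomputable def translateAverage (f : C(X, ℝ)) (μ : Measure X) (x : X) : ℝ :=
  ∫ y, f (y * x) ∂μ

theorem continuous_translateAverage (f : C(X, ℝ)) (μ : Measure X) [IsFiniteMeasure μ] :
    Continuous (translateAverage f μ) :=
  continuous_integral_of_compactSpace (f := fun x y => f (y * x)) (by fun_prop) μ

theorem translateAverage_mconv (f : C(X, ℝ)) (μ ν : Measure X) [IsFiniteMeasure μ]
    [IsFiniteMeasure ν] (x : X) :
    translateAverage f (μ.mconv ν) x = ∫ z, translateAverage f μ (z * x) ∂ν := by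
  have hc : Continuous fun p : X × X => f (p.1 * p.2 * x) := by fun_prop
  rw [translateAverage, integral_mconv (Continuous.integrable_of_compactSpace (by fun_prop) _),
    integral_integral_swap (hc.integrable_of_compactSpace _)]
  simp only [translateAverage, mul_assoc]

variable (m : Measure X)

/-- The squared `L²(m)` norm of the average of `f` over left translates chosen according to `μ`. -/
noncomputable def energy (f : C(X, ℝ)) (μ : Measure X) : ℝ :=
  ∫ x, translateAverage f μ x ^ 2 ∂m

variable [IsProbabilityMeasure m]

theorem continuous_energy (f : C(X, ℝ)) :
    Continuous fun μ : ProbabilityMeasure X => energy m f μ := by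
  have hb : ∀ (μ : ProbabilityMeasure X) (x : X), ‖translateAverage f μ x ^ 2‖ ≤ ‖f‖ ^ 2 := by
    intro μ x
    rw [norm_pow]
    gcongr
    exact (norm_integral_le_of_norm_le_const (ae_of_all _ fun y => f.norm_coe_le_norm _)).trans
      (by simp)
  refine continuous_of_dominated (bound := fun _ => ‖f‖ ^ 2) (fun μ =>
    ((continuous_translateAverage f (μ : Measure X)).pow 2).aestronglyMeasurable)
    (fun μ => ae_of_all _ (hb μ)) (integrable_const _) (ae_of_all _ fun x => ?_)
  exact (ProbabilityMeasure.continuous_integral_continuousMap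
    (⟨fun y => f (y * x), by fun_prop⟩ : C(X, ℝ))).pow 2

/-- The energy lost under convolution by `ν` is the mean over `x` of the variance of
`z ↦ translateAverage f μ (z * x)` under `ν`. -/
theorem energy_sub_energy_mconv [m.IsMulLeftInvariant] (f : C(X, ℝ)) (μ ν : Measure X)
    [IsFiniteMeasure μ] [IsProbabilityMeasure ν] :
    energy m f μ - energy m f (μ.mconv ν) =
      ∫ x, ∫ z, (translateAverage f μ (z * x) - translateAverage f (μ.mconv ν) x) ^ 2 ∂ν ∂m := by
  set F := translateAverage f μ with hF
  have hFc : Continuous F := continuous_translateAverage f μ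
  have hAc : Continuous (translateAverage f (μ.mconv ν)) := continuous_translateAverage f _
  have hvar : ∀ x, ∫ z, (F (z * x) - translateAverage f (μ.mconv ν) x) ^ 2 ∂ν =
      ∫ z, F (z * x) ^ 2 ∂ν - translateAverage f (μ.mconv ν) x ^ 2 := by
    intro x
    have h1 : Integrable (fun z => F (z * x) ^ 2) ν :=
      Continuous.integrable_of_compactSpace (by fun_prop) _
    have h2 : Integrable (fun z => F (z * x)) ν :=
      Continuous.integrable_of_compactSpace (by fun_prop) _
    set c := translateAverage f (μ.mconv ν) x with hc
    have hc' : ∫ z, F (z * x) ∂ν = c := (translateAverage_mconv f μ ν x).symm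
    calc _ = ∫ z, (F (z * x) ^ 2 - (2 * c) * F (z * x) + c ^ 2) ∂ν := by
          congr 1; ext z; ring
      _ = _ := by
          have h3 : Integrable (fun z => (2 * c) * F (z * x)) ν := h2.const_mul _
          rw [integral_add (f := fun z => F (z * x) ^ 2 - (2 * c) * F (z * x)) (h1.sub h3)
            (integrable_const _), integral_sub h1 h3, integral_const_mul, hc']
          simp only [integral_const, probReal_univ, one_smul]
          ring
  have hswap : ∫ x, ∫ z, F (z * x) ^ 2 ∂ν ∂m = energy m f μ := by
    have hc : Continuous fun p : X × X => F (p.2 * p.1) ^ 2 := by fun_prop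
    rw [integral_integral_swap (hc.integrable_of_compactSpace _)]
    simp only [integral_mul_left_eq_self (fun x => F x ^ 2), integral_const, probReal_univ,
      one_smul]
    rfl
  simp only [hvar]
  rw [integral_sub, hswap]
  · rfl
  · exact (continuous_integral_of_compactSpace (f := fun x z => F (z * x) ^ 2)
      (by fun_prop) ν).integrable_of_compactSpace m
  · exact (hAc.pow 2).integrable_of_compactSpace m

theorem energy_mconv_le [m.IsMulLeftInvariant] (f : C(X, ℝ)) (μ ν : Measure X)
    [IsFiniteMeasure μ] [IsProbabilityMeasure ν] : energy m f (μ.mconv ν) ≤ energy m f μ := by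
  rw [← sub_nonneg, energy_sub_energy_mconv]
  exact integral_nonneg fun x => integral_nonneg fun z => sq_nonneg _

/-- If convolution by `ν` loses no energy and `1` is in the support of `ν`, then almost every right
translate of `μ` under `ν` gives `f` the same integral as `μ`. -/
theorem ae_translateAverage_eq [m.IsMulLeftInvariant] [m.IsOpenPosMeasure] {f : C(X, ℝ)}
    {μ ν : Measure X} [IsFiniteMeasure μ] [IsProbabilityMeasure ν]
    (h : energy m f μ ≤ energy m f (μ.mconv ν)) (h1 : 1 ∈ ν.support) :
    ∀ᵐ z ∂ν, translateAverage f μ z = translateAverage f μ 1 := by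
  have hFc : Continuous (translateAverage f μ) := continuous_translateAverage f μ
  have hAc : Continuous (translateAverage f (μ.mconv ν)) := continuous_translateAverage f _
  have hVc : Continuous fun x => ∫ z, (translateAverage f μ (z * x) -
      translateAverage f (μ.mconv ν) x) ^ 2 ∂ν :=
    continuous_integral_of_compactSpace (f := fun x z => (translateAverage f μ (z * x) -
      translateAverage f (μ.mconv ν) x) ^ 2) (by fun_prop) ν
  have hzero := (integral_eq_zero_iff_of_nonneg (μ := m)
    (fun x => integral_nonneg fun z => sq_nonneg _) (hVc.integrable_of_compactSpace m)).1
    (le_antisymm (by rw [← energy_sub_energy_mconv]; linarith)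
      (integral_nonneg fun x => integral_nonneg fun z => sq_nonneg _))
  have hone := congrFun ((hVc.ae_eq_iff_eq m continuous_zero).1 hzero) 1
  have hcont : Continuous fun z => (translateAverage f μ (z * 1) -
      translateAverage f (μ.mconv ν) 1) ^ 2 := by fun_prop
  have hae := (integral_eq_zero_iff_of_nonneg (μ := ν) (fun z => sq_nonneg _)
    (hcont.integrable_of_compactSpace ν)).1 hone
  have hae' : ∀ᵐ z ∂ν, translateAverage f μ z = translateAverage f (μ.mconv ν) 1 := by
    filter_upwards [hae] with z hz
    simpa [sub_eq_zero] using hz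
  -- The level set is closed and conull, so it contains the support of `ν`, and with it `1`.
  have h1' : translateAverage f μ 1 = translateAverage f (μ.mconv ν) 1 :=
    Measure.support_subset_of_isClosed (isClosed_eq hFc continuous_const) hae' h1
  simpa [h1'] using hae'

end Energy

section MinimalIdeal

variable {X : Type*} [Group X] [TopologicalSpace X] [IsTopologicalGroup X]
  [TopologicalSpace.MetrizableSpace X] [MeasurableSpace X] [BorelSpace X]

/-- Convolution of probability measures on a group. -/
noncomputable def MeasureTheory.ProbabilityMeasure.convolution {X : Type*} [Group X]
    [MeasurableSpace X] [MeasurableMul₂ X] (μ ν : ProbabilityMeasure X) :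
    ProbabilityMeasure X :=
  ⟨(μ : Measure X).mconv ν, inferInstance⟩

/-- The elements `z` with `μ * δ_z = μ`, tested against continuous functions: note that
`translateAverage f μ z` is the integral of `f` against `μ * δ_z`. -/
def rightStabilizer (μ : Measure X) [IsFiniteMeasure μ] : Subgroup X where
  carrier := {z | ∀ f : C(X, ℝ), translateAverage f μ z = translateAverage f μ 1}
  one_mem' _ := rfl
  mul_mem' {z w} hz hw f := by
    -- translate `f` on the right by `w`
    have h := hz ⟨fun x => f (x * w), by fun_prop⟩
    have h' := hw f
    simp only [translateAverage, ContinuousMap.coe_mk, mul_one] at h h' ⊢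
    rw [← h', ← h]
    simp only [mul_assoc]
  inv_mem' {z} hz f := by
    have h := hz ⟨fun x => f (x * z⁻¹), by fun_prop⟩
    simp only [translateAverage, ContinuousMap.coe_mk, mul_one, mul_assoc, mul_inv_cancel] at h ⊢
    exact h.symm

theorem map_mul_right_of_mem_rightStabilizer {μ : Measure X} [IsFiniteMeasure μ] {z : X}
    (hz : z ∈ rightStabilizer μ) : μ.map (· * z) = μ := by
  let _ := TopologicalSpace.metrizableSpaceMetric X
  refine ext_of_forall_integral_eq_of_IsFiniteMeasure fun f => ?_
  rw [integral_map (by fun_prop) f.continuous.aestronglyMeasurable]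
  simpa [translateAverage] using hz f.toContinuousMap

variable [CompactSpace X]

theorem isClosed_rightStabilizer (μ : Measure X) [IsFiniteMeasure μ] :
    IsClosed (rightStabilizer μ : Set X) := by
  have : (rightStabilizer μ : Set X) =
      ⋂ f : C(X, ℝ), {z | translateAverage f μ z = translateAverage f μ 1} := by
    ext z; simp [rightStabilizer]
  rw [this]
  exact isClosed_iInter fun f => isClosed_eq (continuous_translateAverage f μ) continuous_const

/-- A nonempty closed convolution semigroup `S` of probability measures contains a measure that is
invariant under right translation by almost every point of any `ν ∈ S` charging all neighbourhoods
of `1`. Such a measure is found in a minimal closed right ideal of `S`: minimality makes the energy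
of every `f` constant on that ideal. -/
theorem exists_forall_rightStabilizer_mem_ae {S : Set (ProbabilityMeasure X)} (hne : S.Nonempty)
    (hcl : IsClosed S) (hmul : ∀ μ ∈ S, ∀ ν ∈ S, μ.convolution ν ∈ S) :
    ∃ μ ∈ S, ∀ ν ∈ S, 1 ∈ (ν : Measure X).support →
      ∀ᵐ z ∂(ν : Measure X), z ∈ rightStabilizer (μ : Measure X) := by
  let m : Measure X := Measure.haarMeasure ⊤
  have hm : IsProbabilityMeasure m :=
    ⟨Measure.haarMeasure_self (K₀ := (⊤ : TopologicalSpace.PositiveCompacts X))⟩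
  let 𝓘 : Set (Set (ProbabilityMeasure X)) :=
    {R | R ⊆ S ∧ IsClosed R ∧ R.Nonempty ∧ ∀ μ ∈ R, ∀ ν ∈ S, μ.convolution ν ∈ R}
  obtain ⟨R, -, hR⟩ := zorn_superset_nonempty 𝓘 (fun c hc hchain hcne => by
    refine ⟨⋂₀ c, ⟨?_, isClosed_sInter fun R hR => (hc hR).2.1, ?_, ?_⟩,
      fun R hR => Set.sInter_subset_of_mem hR⟩
    · obtain ⟨R, hR⟩ := hcne
      exact (Set.sInter_subset_of_mem hR).trans (hc hR).1
    · exact IsCompact.nonempty_sInter_of_directed_nonempty_isCompact_isClosed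
        (hS := hcne.to_subtype) (IsChain.directedOn hchain.symm) (fun R hR => (hc hR).2.2.1)
        (fun R hR => (hc hR).2.1.isCompact) (fun R hR => (hc hR).2.1)
    · exact fun μ hμ ν hν R hR => (hc hR).2.2.2 μ (hμ R hR) ν hν)
    S ⟨subset_rfl, hcl, hne, hmul⟩
  obtain ⟨hRS, hRcl, hRne, hRmul⟩ := hR.prop
  have hconst : ∀ (f : C(X, ℝ)), ∀ μ ∈ R, ∀ ν ∈ R, energy m f μ ≤ energy m f ν := by
    intro f
    have hmin : {μ ∈ R | ∀ ν ∈ R, energy m f μ ≤ energy m f ν} ∈ 𝓘 := by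
      refine ⟨fun μ hμ => hRS hμ.1, ?_, ?_, ?_⟩
      · have : {μ ∈ R | ∀ ν ∈ R, energy m f μ ≤ energy m f ν} =
            R ∩ ⋂ ν ∈ R, {μ | energy m f μ ≤ energy m f ν} := by
          ext; simp
        rw [this]
        exact hRcl.inter (isClosed_biInter fun ν _ =>
          isClosed_le (continuous_energy m f) continuous_const)
      · obtain ⟨μ, hμ, h⟩ := hRcl.isCompact.exists_isMinOn hRne
          (continuous_energy m f).continuousOn
        exact ⟨μ, hμ, h⟩
      · exact fun μ hμ ν hν => ⟨hRmul μ hμ.1 ν hν, fun ρ hρ =>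
          (energy_mconv_le m f μ ν).trans (hμ.2 ρ hρ)⟩
    intro μ hμ
    exact (hR.le_of_le hmin (fun ρ hρ => hρ.1) hμ).2
  obtain ⟨μ, hμ⟩ := hRne
  refine ⟨μ, hRS hμ, fun ν hν h1 => ?_⟩
  filter_upwards [(ν : Measure X).support_mem_ae] with z hz f
  exact Measure.support_subset_of_isClosed
    (isClosed_eq (continuous_translateAverage f μ) continuous_const)
    (ae_translateAverage_eq m (hconst f μ hμ _ (hRmul μ hμ ν hν)) h1) hz

end MinimalIdeal

/-! ### The invariant subgroup -/

namespace PMPAction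

variable {G : Type u} [Group G]

/-- If a factor map `a → b` is a measurable embedding, such as the inclusion of a conull invariant
set, then weak containment passes from `b` back to `a`, because observables of `a` extend to `b`. -/
theorem WeaklyContained.of_measurableEmbedding {a b : PMPAction G} {C : Set (PMPAction G)}
    (hb : b.WeaklyContained C) {Θ : a.carrier → b.carrier}
    (hΘ : MeasurePreserving Θ a.measure b.measure) (hemb : MeasurableEmbedding Θ)
    (heq : ∀ (g : G) z, Θ (g • z) = g • Θ z) : a.WeaklyContained C := by
  refine WeaklyContained.trans (D := {b}) (fun ε hε F A _ α hα => ?_) fun _ hd => hd ▸ hb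
  have : Nonempty A := ⟨α (nonempty_of_isProbabilityMeasure a.measure).some⟩
  let _ : MeasurableSpace A := ⊤
  obtain ⟨β, hβ, rfl⟩ := hemb.exists_measurable_extend hα fun _ => this
  exact ⟨b, rfl, β, hβ, by simpa [law_comp a b hΘ heq hβ] using hε⟩

theorem WeaklyContained.map_mem_containedMeasures {a : PMPAction G} {C : Set (PMPAction G)}
    (ha : a.WeaklyContained C) {X : Type u} [MeasurableSpace X] [MulAction G X]
    [MeasurableConstSMul G X] {Θ : a.carrier → X} (hΘ : Measurable Θ)
    (heq : ∀ (g : G) z, Θ (g • z) = g • Θ z) :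
    (⟨a.measure.map Θ, Measure.isProbabilityMeasure_map hΘ.aemeasurable⟩ : ProbabilityMeasure X) ∈
      containedMeasures C X := by
  have := Measure.isProbabilityMeasure_map (μ := a.measure) hΘ.aemeasurable
  have hinv : ∀ g : G, MeasurePreserving (fun x : X => g • x) (a.measure.map Θ)
      (a.measure.map Θ) := by
    refine fun g => ⟨measurable_const_smul g, ?_⟩
    rw [Measure.map_map (measurable_const_smul g) hΘ,
      show (fun x : X => g • x) ∘ Θ = Θ ∘ fun z => g • z from funext fun z => (heq g z).symm,
      ← Measure.map_map hΘ (a.measurePreserving_smul g).measurable,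
      (a.measurePreserving_smul g).map_eq]
  exact ⟨hinv, ha.of_factor (b := ofMeasure (a.measure.map Θ) hinv) ⟨hΘ, rfl⟩ heq⟩

variable {X : Type u} [Group X] [TopologicalSpace X] [IsTopologicalGroup X] [CompactSpace X]
  [TopologicalSpace.MetrizableSpace X] [MeasurableSpace X] [BorelSpace X]
  [MulDistribMulAction G X] [ContinuousConstSMul G X]

theorem convolution_mem_containedMeasures {C : Set (PMPAction G)}
    (hC : WeaklyClosedUnderProducts C) {μ ν : ProbabilityMeasure X}
    (hμ : μ ∈ containedMeasures C X) (hν : ν ∈ containedMeasures C X) :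
    μ.convolution ν ∈ containedMeasures C X := by
  obtain ⟨hμ, hμC⟩ := hμ
  obtain ⟨hν, hνC⟩ := hν
  have hm : Measurable fun p : X × X => p.1 * p.2 := measurable_mul
  have heq : ∀ (g : G) (p : X × X), (g • p).1 * (g • p).2 = g • (p.1 * p.2) :=
    fun g p => (smul_mul' g p.1 p.2).symm
  have h := hμC.prod hC hνC
  exact h.map_mem_containedMeasures (X := X) (Θ := fun p : X × X => p.1 * p.2) hm heq

/-- The law of `Θ(z)⁻¹Θ(w)`, for `z` and `w` independent. -/
noncomputable def differenceLaw {Ω : Type*} [MeasurableSpace Ω] (μ : Measure Ω) (Θ : Ω → X) :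
    Measure X :=
  (μ.prod μ).map fun p => (Θ p.1)⁻¹ * Θ p.2

theorem one_mem_support_differenceLaw {Ω : Type*} [MeasurableSpace Ω] (μ : Measure Ω)
    [IsProbabilityMeasure μ] {Θ : Ω → X} (hΘ : Measurable Θ) :
    1 ∈ (differenceLaw μ Θ).support := by
  have := Measure.isProbabilityMeasure_map (μ := μ) hΘ.aemeasurable
  obtain ⟨x, hx⟩ := Measure.nonempty_support (μ := μ.map Θ) (NeZero.ne _)
  refine (Measure.mem_support_iff_forall 1).2 fun U hU => ?_
  -- a neighbourhood `V` of a point of the support with `V⁻¹V ⊆ U`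
  have hcont : Tendsto (fun p : X × X => p.1⁻¹ * p.2) (𝓝 x ×ˢ 𝓝 x) (𝓝 1) := by
    rw [← nhds_prod_eq]
    have : Continuous fun p : X × X => p.1⁻¹ * p.2 := by fun_prop
    simpa using this.tendsto (x, x)
  obtain ⟨V, hV, hVU⟩ := mem_prod_same_iff.1 (hcont hU)
  obtain ⟨W, hWV, hWo, hxW⟩ := mem_nhds_iff.1 hV
  have hpos : 0 < μ (Θ ⁻¹' W) := by
    rw [← Measure.map_apply hΘ hWo.measurableSet]
    exact (Measure.mem_support_iff_forall x).1 hx W (hWo.mem_nhds hxW)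
  calc 0 < μ (Θ ⁻¹' W) * μ (Θ ⁻¹' W) := ENNReal.mul_pos hpos.ne' hpos.ne'
    _ = (μ.prod μ) ((Θ ⁻¹' W) ×ˢ (Θ ⁻¹' W)) := (Measure.prod_prod _ _).symm
    _ ≤ (μ.prod μ) ((fun p => (Θ p.1)⁻¹ * Θ p.2) ⁻¹' U) :=
        measure_mono fun p hp =>
          hVU (Set.mk_mem_prod (hWV (show Θ p.1 ∈ W from hp.1)) (hWV (show Θ p.2 ∈ W from hp.2)))
    _ ≤ differenceLaw μ Θ U := Measure.le_map_apply
        (Measurable.aemeasurable (by fun_prop)) U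

theorem WeaklyContained.differenceLaw_mem_containedMeasures {C : Set (PMPAction G)}
    (hC : WeaklyClosedUnderProducts C) {a : PMPAction G} (ha : a.WeaklyContained C)
    {Θ : a.carrier → X} (hΘ : Measurable Θ) (heq : ∀ (g : G) z, Θ (g • z) = g • Θ z) :
    ∃ h, (⟨differenceLaw a.measure Θ, h⟩ : ProbabilityMeasure X) ∈ containedMeasures C X :=
  ⟨_, (ha.prod hC ha).map_mem_containedMeasures
    (Θ := fun p : a.carrier × a.carrier => (Θ p.1)⁻¹ * Θ p.2) (by fun_prop) fun g z => by
      change (Θ (g • z.1))⁻¹ * Θ (g • z.2) = g • ((Θ z.1)⁻¹ * Θ z.2)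
      rw [heq, heq, smul_mul', smul_inv']⟩

/-- Left translation of `x⁻¹y` by `z` amounts to right translation of `x` by `z⁻¹`. -/
theorem map_mul_left_differenceLaw {μ : Measure X} [IsFiniteMeasure μ] {z : X}
    (hz : z ∈ rightStabilizer μ) :
    (differenceLaw μ (id : X → X)).map (z * ·) = differenceLaw μ (id : X → X) := by
  have hz' : μ.map (· * z⁻¹) = μ :=
    map_mul_right_of_mem_rightStabilizer ((rightStabilizer μ).inv_mem hz)
  have hprod : (μ.prod μ).map (Prod.map (· * z⁻¹) id) = μ.prod μ := by
    rw [← Measure.map_prod_map _ _ (by fun_prop) measurable_id, hz', Measure.map_id]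
  conv_rhs => rw [differenceLaw, ← hprod]
  rw [differenceLaw, Measure.map_map (by fun_prop) (by fun_prop),
    Measure.map_map (by fun_prop) (by fun_prop)]
  congr 1
  ext p
  simp [mul_assoc]

theorem isClosedInvariant_rightStabilizer {μ : Measure X} [IsFiniteMeasure μ]
    (h : ∀ g : G, MeasurePreserving (fun x : X => g • x) μ μ) :
    IsClosedInvariant G (rightStabilizer μ) := by
  refine ⟨isClosed_rightStabilizer μ, fun g z hz f => ?_⟩
  have hinv : ∀ k : C(X, ℝ), ∫ y, k (g • y) ∂μ = ∫ y, k y ∂μ := fun k => by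
    conv_rhs => rw [← (h g).map_eq]
    exact (integral_map (h g).measurable.aemeasurable k.continuous.aestronglyMeasurable).symm
  have hz' := hz ⟨fun x => f (g • x), by fun_prop⟩
  simp only [translateAverage, ContinuousMap.coe_mk, mul_one, smul_mul'] at hz' ⊢
  rw [← hinv f, ← hz']
  exact (hinv ⟨fun y => f (y * g • z), by fun_prop⟩).symm

/-- A probability measure carried by a closed subgroup and invariant under left translation by its
elements is the Haar measure of the subgroup. -/
theorem map_subtype_val_haarMeasure {H : Subgroup X} [CompactSpace H] (hcl : IsClosed (H : Set X))
    {ν : Measure X} [IsProbabilityMeasure ν] (hH : ∀ᵐ x ∂ν, x ∈ H)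
    (hinv : ∀ z ∈ H, ν.map (z * ·) = ν) :
    (Measure.haarMeasure (⊤ : TopologicalSpace.PositiveCompacts H)).map Subtype.val = ν := by
  have hemb : MeasurableEmbedding (Subtype.val : H → X) :=
    MeasurableEmbedding.subtype_coe hcl.measurableSet
  have hmap : (ν.comap (Subtype.val : H → X)).map Subtype.val = ν := by
    rw [hemb.map_comap, Subtype.range_coe_subtype]
    exact Measure.restrict_eq_self_of_ae_mem hH
  have huniv : ν.comap (Subtype.val : H → X) Set.univ = 1 := by
    rw [hemb.comap_apply, Set.image_univ, Subtype.range_coe_subtype]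
    exact (mem_ae_iff_prob_eq_one hcl.measurableSet).1 hH
  have : IsFiniteMeasure (ν.comap (Subtype.val : H → X)) := ⟨by simp [huniv]⟩
  have : (ν.comap (Subtype.val : H → X)).IsMulLeftInvariant := by
    refine ⟨fun z => ?_⟩
    rw [← hemb.map_injective.eq_iff]
    rw [Measure.map_map hemb.measurable (measurable_const_mul z), hmap]
    conv_rhs => rw [← hinv z z.2, ← hmap]
    rw [Measure.map_map (measurable_const_mul _) hemb.measurable]
    rfl
  have : SecondCountableTopology H :=
    TopologicalSpace.Subtype.secondCountableTopology (H : Set X)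
  have h := Measure.haarMeasure_unique (ν.comap (Subtype.val : H → X)) ⊤
  rw [show (((⊤ : TopologicalSpace.PositiveCompacts H) : Set H)) = Set.univ from rfl, huniv,
    one_smul] at h
  rw [← h, hmap]

end PMPAction

namespace IsClosedInvariant

open PMPAction

variable {G X : Type u} [Group G] [Group X] [TopologicalSpace X] [IsTopologicalGroup X]
  [CompactSpace X] [MeasurableSpace X] [BorelSpace X]
  [MulDistribMulAction G X] [ContinuousConstSMul G X]

/-- A closed set containing almost every point of a closed subgroup contains the subgroup. -/
theorem forall_mem_of_ae {Y : Subgroup X} (h : IsClosedInvariant G Y) {K : Set X}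
    (hK : IsClosed K) (hae : ∀ᵐ y ∂h.haarAction.measure, (y : Y).1 ∈ K) : ∀ y ∈ Y, y ∈ K := by
  have : CompactSpace Y := isCompact_iff_compactSpace.mp h.isClosed.isCompact
  intro y hy
  have hsub := Measure.support_subset_of_isClosed
    (μ := Measure.haarMeasure (⊤ : TopologicalSpace.PositiveCompacts Y))
    (hK.preimage continuous_subtype_val) hae
  rw [Measure.support_eq_univ] at hsub
  exact hsub (Set.mem_univ (⟨y, hy⟩ : Y))

theorem one_mem_support_map_haar {Y : Subgroup X} (h : IsClosedInvariant G Y) :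
    1 ∈ (h.haarAction.measure.map (Subtype.val : Y → X)).support := by
  have : CompactSpace Y := isCompact_iff_compactSpace.mp h.isClosed.isCompact
  refine (Measure.mem_support_iff_forall 1).2 fun U hU => ?_
  have hpos : 0 < Measure.haarMeasure (⊤ : TopologicalSpace.PositiveCompacts Y)
      ((Subtype.val : Y → X) ⁻¹' U) :=
    Measure.measure_pos_of_mem_nhds _ (continuous_subtype_val.continuousAt.preimage_mem_nhds
      (x := (1 : Y)) hU)
  exact hpos.trans_le (Measure.le_map_apply measurable_subtype_coe.aemeasurable U)

end IsClosedInvariant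

section

open PMPAction

variable {G X : Type u} [Group G] [Group X] [TopologicalSpace X] [IsTopologicalGroup X]
  [CompactSpace X] [TopologicalSpace.MetrizableSpace X] [MeasurableSpace X] [BorelSpace X]
  [MulDistribMulAction G X] [ContinuousConstSMul G X]

/-- The subgroup is the right stabilizer of a measure in a minimal closed right ideal of
`containedMeasures C X`. -/
theorem exists_isGreatest_weaklyContained_isLeast_ergodicInPresence
    {C : Set (PMPAction G)} (hne : C.Nonempty)
    (hC : WeaklyClosedUnderProducts C) :
    ∃ Y : Subgroup X,
      IsGreatest {Y : Subgroup X | ∃ h : IsClosedInvariant G Y,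
        h.haarAction.WeaklyContained C} Y ∧
      IsLeast {Y : Subgroup X | IsClosedInvariant G Y ∧
        ∀ a : PMPAction G, a.WeaklyContained C →
          a.ErgodicInPresence (QuotientGroup.mk : X → X ⧸ Y)} Y := by
  have hS : (containedMeasures C X).Nonempty := by
    obtain ⟨c, hc⟩ := hne
    exact ⟨_, (weaklyContained_of_mem hc).map_mem_containedMeasures
      (Θ := fun _ => (1 : X)) measurable_const fun g _ => (smul_one g).symm⟩
  obtain ⟨μ, ⟨hμ, hμC⟩, hμae⟩ := exists_forall_rightStabilizer_mem_ae hS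
    (isClosed_containedMeasures C) fun μ hμ ν hν => convolution_mem_containedMeasures hC hμ hν
  set Y := rightStabilizer (μ : Measure X) with hY
  have hYinv : IsClosedInvariant G Y := isClosedInvariant_rightStabilizer hμ
  have : CompactSpace Y := isCompact_iff_compactSpace.mp hYinv.isClosed.isCompact
  have hdiff : ∀ a : PMPAction G, a.WeaklyContained C → ∀ Θ : a.carrier → X, Measurable Θ →
      (∀ (g : G) z, Θ (g • z) = g • Θ z) → ∀ᵐ x ∂differenceLaw a.measure Θ, x ∈ Y := by
    intro a ha Θ hΘ heq
    obtain ⟨_, h⟩ := ha.differenceLaw_mem_containedMeasures hC hΘ heq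
    exact hμae _ h (one_mem_support_differenceLaw a.measure hΘ)
  -- The law of `x⁻¹y`, for `x` and `y` independent of law `μ`, is the Haar measure of `Y`.
  have hYC : hYinv.haarAction.WeaklyContained C := by
    have hid : Measurable (id : X → X) := measurable_id
    obtain ⟨hprob, hinv, hνC⟩ := hμC.differenceLaw_mem_containedMeasures (X := X) hC
      (Θ := (id : X → X)) hid fun g z => rfl
    have hae : ∀ᵐ x ∂differenceLaw (μ : Measure X) (id : X → X), x ∈ Y :=
      hdiff _ hμC (id : X → X) hid fun g z => rfl
    have : IsProbabilityMeasure (differenceLaw (μ : Measure X) (id : X → X)) := hprob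
    have hmap := map_subtype_val_haarMeasure hYinv.isClosed hae
      fun z hz => map_mul_left_differenceLaw hz
    exact hνC.of_measurableEmbedding (Θ := (Subtype.val : Y → X)) ⟨measurable_subtype_coe, hmap⟩
      (MeasurableEmbedding.subtype_coe hYinv.isClosed.measurableSet) fun g z => rfl
  refine ⟨Y, ⟨⟨hYinv, hYC⟩, ?_⟩, ⟨hYinv, ?_⟩, ?_⟩
  · rintro Z ⟨hZ, hZC⟩
    refine hZ.forall_mem_of_ae hYinv.isClosed ?_
    exact ae_of_ae_map measurable_subtype_coe.aemeasurable
      (hμae _ (hZC.map_mem_containedMeasures (Θ := (Subtype.val : Z → X)) measurable_subtype_coe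
        fun g z => rfl) hZ.one_mem_support_map_haar)
  · intro a ha Θ hΘ heq
    have h := ae_of_ae_map (by fun_prop) (hdiff a ha Θ hΘ heq)
    obtain ⟨z, hz⟩ := (Measure.ae_ae_of_ae_prod h).exists
    exact ⟨Θ z, hz.mono fun w hw => (QuotientGroup.eq.2 hw).symm⟩
  · rintro Z ⟨hZ, hZerg⟩ y hy
    obtain ⟨v, hv⟩ := hZerg _ hYC (Subtype.val : Y → X) measurable_subtype_coe fun g z => rfl
    obtain ⟨x, rfl⟩ := QuotientGroup.mk_surjective v
    have hcl : IsClosed {y : X | x⁻¹ * y ∈ Z} :=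
      hZ.isClosed.preimage (continuous_const_mul x⁻¹)
    have hall := hYinv.forall_mem_of_ae hcl
      (hv.mono fun y hy => QuotientGroup.eq.1 (Eq.symm hy))
    -- the coset `xZ` contains `Y`, in particular `1`, so it is `Z`
    have h1 := hall 1 Y.one_mem
    have h2 := Z.mul_mem (Z.inv_mem h1) (hall y hy)
    simpa using h2

end

theorem theorem1p1 {G X : Type u} [Group G] [Countable G]
    [Group X] [TopologicalSpace X] [IsTopologicalGroup X] [CompactSpace X]
    [TopologicalSpace.MetrizableSpace X] [MeasurableSpace X] [BorelSpace X]
    [MulDistribMulAction G X] [ContinuousConstSMul G X] :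
    (∃ Y : Subgroup X,
      IsGreatest {Y : Subgroup X | ∃ h : IsClosedInvariant G Y,
        h.haarAction.WeaklyContainedInBernoulli} Y ∧
      IsLeast {Y : Subgroup X | IsClosedInvariant G Y ∧
        ∀ a : PMPAction G, a.WeaklyContainedInBernoulli →
          a.ErgodicInPresence (QuotientGroup.mk : X → X ⧸ Y)} Y) ∧
    (∀ C : Set (PMPAction G), C.Nonempty → PMPAction.WeaklyClosedUnderProducts C →
      ∃ Y : Subgroup X,
        IsGreatest {Y : Subgroup X | ∃ h : IsClosedInvariant G Y,
          h.haarAction.WeaklyContained C} Y ∧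
        IsLeast {Y : Subgroup X | IsClosedInvariant G Y ∧
          ∀ a : PMPAction G, a.WeaklyContained C →
            a.ErgodicInPresence (QuotientGroup.mk : X → X ⧸ Y)} Y) := by
  refine ⟨?_, fun C hne hC => exists_isGreatest_weaklyContained_isLeast_ergodicInPresence hne hC⟩
  simp only [PMPAction.weaklyContainedInBernoulli_iff]
  exact exists_isGreatest_weaklyContained_isLeast_ergodicInPresence (Set.singleton_nonempty _)
    PMPAction.weaklyClosedUnderProducts_bernoulli
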